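/- Theorem 3.2. Let $X$ be an infinite dimensional complex Banach space, let $B(X)$ be the Banach algebra of all bounded linear operators on $X$, let $A\in B(X)$, and let $L_A,R_A\in B(B(X))$ be the multiplication operators $L_A(T)=AT$ and $R_A(T)=TA$. For a bounded operator $T$ on a complex Banach space $Y$ write $N(T)$ and $R(T)$ for its kernel and range and $T-\lambda$ for $T-\lambda I$. The operator $T$ is Fredholm if $\dim N(T)$ and $\dim Y/R(T)$ are finite, and its index is then $\dim N(T)-\dim Y/R(T)$; it is Weyl if it is Fredholm of index $0$; it is B-Weyl if for some $n\in\mathbb N$ the range $R(T^n)$ is closed and the operator on $R(T^n)$ induced by $T$ is Fredholm of index $0$; it is Drazin invertible if there are a bounded operator $S$ on $Y$ and $m\in\mathbb N$ with $T^m=T^mST$, $STS=S$, $TS=ST$. Let $\sigma_w(T)$, $\sigma_{BW}(T)$ and $\sigma_{DR}(T)$ be the sets of all $\lambda\in\mathbb C$ for which $T-\lambda$ is not Weyl, not B-Weyl, and not Drazin invertible, respectively, and let $\sigma(T)$ be the spectrum of $T$. The ascent (descent) of $T$ is the least integer $n\ge 0$ with $N(T^n)=N(T^{n+1})$ (with $R(T^n)=R(T^{n+1})$),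 or $\infty$ if there is none. Let $\Pi_0(T)$ be the set of all $\lambda\in\mathbb C$ such that the ascent and the descent of $T-\lambda$ are finite and equal and $\dim N(T-\lambda)<\infty$. Browder's theorem is said to hold for $T$ if $\sigma_w(T)=\sigma(T)\setminus\Pi_0(T)$. Then Browder's theorem holds for $L_A$ and for $R_A$. Moreover, (i) $\sigma_{BW}(A)\subseteq\sigma_{BW}(L_A)=\sigma_{DR}(L_A)=\sigma_{DR}(A)$, and (ii) $\sigma_{BW}(A)\subseteq\sigma_{BW}(R_A)=\sigma_{DR}(R_A)=\sigma_{DR}(A)$. Furthermore, each of the following is equivalent to Browder's theorem holding for $A$: (iii) $\sigma_{BW}(L_A)=\sigma_{BW}(A)$; (iv) $\sigma_{BW}(R_A)=\sigma_{BW}(A)$. -/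

import Mathlib

namespace BrowderWeyl

noncomputable section

variable {E : Type*} [NormedAddCommGroup E] [NormedSpace ℂ E]

/-- The shifted operator `T - z`, that is `T - z I`. -/
def shift (T : E →L[ℂ] E) (z : ℂ) : E →L[ℂ] E := T - z • (1 : E →L[ℂ] E)

/-- The index `dim N(T) - dim E / R(T)`, meaningful when `T` is Fredholm. -/
def index (T : E →L[ℂ] E) : ℤ :=
  (Module.finrank ℂ T.ker : ℤ) - (Module.finrank ℂ (E ⧸ T.range) : ℤ)

/-- A Weyl operator: a Fredholm operator of index zero. (On a Banach space Mathlib's `IsFredholm`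
amounts to finite dimensional kernel and cokernel.) -/
def IsWeyl (T : E →L[ℂ] E) : Prop := T.IsFredholm ∧ index T = 0

/-- The Weyl spectrum `σ_w`. -/
def weylSpectrum (T : E →L[ℂ] E) : Set ℂ := {z | ¬ IsWeyl (shift T z)}

lemma mapsTo_range_pow (T : E →L[ℂ] E) (n : ℕ) :
    Set.MapsTo T ((T ^ n).range : Set E) ((T ^ n).range : Set E) := by
  rintro _ ⟨x, rfl⟩
  refine ⟨T x, ?_⟩
  have h : (T ^ n) * T = T * (T ^ n) := (pow_succ T n).symm.trans (pow_succ' T n)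
  exact congrArg (fun S : E →L[ℂ] E => S x) h

/-- The operator `T_n` induced by `T` on `R(T ^ n)`. -/
def restrictRangePow (T : E →L[ℂ] E) (n : ℕ) : (T ^ n).range →L[ℂ] (T ^ n).range :=
  T.restrict (mapsTo_range_pow T n)

/-- A B-Weyl (Berkani Weyl) operator: for some `n` the range `R(T ^ n)` is closed and the induced
operator on it is Fredholm of index zero. -/
def IsBWeyl (T : E →L[ℂ] E) : Prop :=
  ∃ n : ℕ, IsClosed ((T ^ n).range : Set E) ∧
    (restrictRangePow T n).IsFredholm ∧ index (restrictRangePow T n) = 0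

/-- The B-Weyl spectrum `σ_BW`. -/
def bWeylSpectrum (T : E →L[ℂ] E) : Set ℂ := {z | ¬ IsBWeyl (shift T z)}

/-- Drazin invertibility in the algebra `B(E)`. -/
def IsDrazinInvertible (T : E →L[ℂ] E) : Prop :=
  ∃ (S : E →L[ℂ] E) (m : ℕ), T ^ m = T ^ m * S * T ∧ S * T * S = S ∧ T * S = S * T

/-- The Drazin spectrum `σ_DR`. -/
def drazinSpectrum (T : E →L[ℂ] E) : Set ℂ := {z | ¬ IsDrazinInvertible (shift T z)}

/-- The ascent: the least `n` with `N(T ^ n) = N(T ^ (n + 1))`, and `⊤` if there is none. -/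
def ascent (T : E →L[ℂ] E) : ℕ∞ :=
  sInf ((fun n : ℕ => (n : ℕ∞)) '' {n : ℕ | (T ^ n).ker = (T ^ (n + 1)).ker})

/-- The descent: the least `n` with `R(T ^ n) = R(T ^ (n + 1))`, and `⊤` if there is none. -/
def descent (T : E →L[ℂ] E) : ℕ∞ :=
  sInf ((fun n : ℕ => (n : ℕ∞)) '' {n : ℕ | (T ^ n).range = (T ^ (n + 1)).range})

/-- The set `Π(T)`: ascent and descent of `T - z` are finite and equal. Points of the
resolvent set belong to it too (ascent and descent are `0` there). -/
def poles (T : E →L[ℂ] E) : Set ℂ :=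
  {z | ascent (shift T z) = descent (shift T z) ∧ ascent (shift T z) < ⊤}

/-- The set `Π₀(T)`: the points `z` of `Π(T)` for which `N(T - z)` is finite dimensional. -/
def finiteRankPoles (T : E →L[ℂ] E) : Set ℂ :=
  {z | z ∈ poles T ∧ FiniteDimensional ℂ (shift T z).ker}

/-- Browder's theorem holds for `T`: `σ_w(T) = σ(T) \ Π₀(T)`. -/
def BrowdersTheorem (T : E →L[ℂ] E) : Prop :=
  weylSpectrum T = spectrum ℂ T \ finiteRankPoles T

/-- The left multiplication operator `L_A : B(E) → B(E)`, `T ↦ A T`. -/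
def leftMul (A : E →L[ℂ] E) : (E →L[ℂ] E) →L[ℂ] (E →L[ℂ] E) :=
  ContinuousLinearMap.mul ℂ (E →L[ℂ] E) A

/-- The right multiplication operator `R_A : B(E) → B(E)`, `T ↦ T A`. -/
def rightMul (A : E →L[ℂ] E) : (E →L[ℂ] E) →L[ℂ] (E →L[ℂ] E) :=
  (ContinuousLinearMap.mul ℂ (E →L[ℂ] E)).flip A

end

end BrowderWeyl

/-!
# Browder's theorem and multiplication operators

Three facts carry the proof.

*Multiplication operators have large kernels.* When `X` is infinite dimensional, every nonzero
operator annihilated by `L_A` and lying in the range of `L_A ^ n` produces, by composition with rank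
one operators, an infinite dimensional space of such operators, and likewise for `R_A`
(`hasLargeKernels_leftMul`, `hasLargeKernels_rightMul`). So as soon as the operator induced
on the range of a power is Fredholm of index zero it is injective, hence bijective, which makes
the multiplication operator Drazin invertible (`HasLargeKernels.isDrazinInvertible`). This gives
Browder's theorem for `L_A` and `R_A` and the equality of their B-Weyl and Drazin spectra.

*Drazin inverses commute with the commutant.* A Drazin inverse of `L_A` therefore commutes with all
right multiplications and is itself a left multiplication, so `L_A` is Drazin invertible exactly
when `A` is (`isDrazinInvertible_leftMul_iff`, `isDrazinInvertible_rightMul_iff`).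

*Browder's theorem for `A` says that the B-Weyl and Drazin spectra of `A` agree*
(`browdersTheorem_iff_bWeylSpectrum_eq`). Since Drazin invertibility means finite ascent and
descent, Browder's theorem says that all Weyl shifts of `A` are Drazin invertible
(`browdersTheorem_iff`). For the nontrivial implication let `T = A - z` be B-Weyl, and let `S` be
the induced operator on `R(T ^ n)`, a Weyl operator. The hyperrange `W = ⋂ R(S ^ k)` is closed, and
`S`
maps it onto itself. If `N(S) ∩ W = 0`, then `S` has finite ascent, and since its powers have
index zero it has finite descent, so `S` and `T` are Drazin invertible. Otherwise `S`, restricted to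
`W`, is surjective but not injective, so all small numbers are eigenvalues of `S`, hence of `T`
(`IsWeyl.isDrazinInvertible_or_eventually_not_injective`). But for small `w ≠ 0` the operator
`T - w` is Weyl, because `S - w` is and `T - w` is bijective on the quotient by `R(T ^ n)`. By
Browder's theorem `T - w` is then Drazin invertible, so that `w` has a punctured neighborhood free of
eigenvalues of `T`, a contradiction.
-/

namespace BrowderWeyl

/-! ### Kernels and cokernels of restrictions -/

section Algebra

variable {V W : Type*} [AddCommGroup V] [Module ℂ V] [AddCommGroup W] [Module ℂ W]

/-- If `M` is the preimage of `N` under `f`, then `f` and its restriction `M → N` have the same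
kernel. -/
noncomputable def kerRestrictEquiv (f : V →ₗ[ℂ] W) {M : Submodule ℂ V} {N : Submodule ℂ W}
    (h : ∀ x ∈ M, f x ∈ N) (h₁ : ∀ x, f x ∈ N → x ∈ M) :
    LinearMap.ker (f.restrict h) ≃ₗ[ℂ] LinearMap.ker f where
  toFun x := ⟨x.1.1, congrArg Subtype.val x.2⟩
  invFun x := ⟨⟨x.1, h₁ _ (by rw [LinearMap.mem_ker.1 x.2]; exact N.zero_mem)⟩,
    Subtype.ext x.2⟩
  map_add' _ _ := rfl
  map_smul' _ _ := rfl
  left_inv _ := rfl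
  right_inv _ := rfl

/-- If `M` is the preimage of `N` under `f`, and `N` together with the range of `f` spans the
codomain, then `f` and its restriction `M → N` have the same cokernel. -/
noncomputable def cokerRestrictEquiv (f : V →ₗ[ℂ] W) {M : Submodule ℂ V} {N : Submodule ℂ W}
    (h : ∀ x ∈ M, f x ∈ N) (h₁ : ∀ x, f x ∈ N → x ∈ M) (h₂ : ∀ y, ∃ x, y - f x ∈ N) :
    (N ⧸ LinearMap.range (f.restrict h)) ≃ₗ[ℂ] W ⧸ LinearMap.range f :=
  (Submodule.quotEquivOfEq _ _ (by
    ext ⟨y, hy⟩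
    constructor
    · rintro ⟨x, hx⟩
      rw [LinearMap.mem_ker, LinearMap.comp_apply, Submodule.mkQ_apply,
        Submodule.Quotient.mk_eq_zero]
      exact ⟨x.1, congrArg Subtype.val hx⟩
    · intro hy'
      rw [LinearMap.mem_ker, LinearMap.comp_apply, Submodule.mkQ_apply,
        Submodule.Quotient.mk_eq_zero] at hy'
      obtain ⟨x, hx⟩ := hy'
      exact ⟨⟨x, h₁ x (by rw [hx]; exact hy)⟩, Subtype.ext hx⟩)).trans
  (((LinearMap.range f).mkQ.comp N.subtype).quotKerEquivOfSurjective (by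
    intro q
    obtain ⟨y, rfl⟩ := Submodule.mkQ_surjective _ q
    obtain ⟨x, hx⟩ := h₂ y
    refine ⟨⟨_, hx⟩, ?_⟩
    rw [LinearMap.comp_apply, Submodule.mkQ_apply, Submodule.mkQ_apply, Submodule.Quotient.eq]
    exact ⟨-x, by simp⟩))

end Algebra

/-! ### Ascent and descent -/

section FiniteAscentDescent

variable {E : Type*} [NormedAddCommGroup E] [NormedSpace ℂ E]

lemma pow_succ_apply (T : E →L[ℂ] E) (n : ℕ) (x : E) : (T ^ (n + 1)) x = (T ^ n) (T x) :=
  congrArg (fun S : E →L[ℂ] E => S x) (pow_succ T n)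

lemma pow_succ_apply' (T : E →L[ℂ] E) (n : ℕ) (x : E) : (T ^ (n + 1)) x = T ((T ^ n) x) :=
  congrArg (fun S : E →L[ℂ] E => S x) (pow_succ' T n)

lemma pow_add_apply (T : E →L[ℂ] E) (m n : ℕ) (x : E) :
    (T ^ (m + n)) x = (T ^ m) ((T ^ n) x) :=
  congrArg (fun S : E →L[ℂ] E => S x) (pow_add T m n)

lemma ker_pow_le_ker_pow (T : E →L[ℂ] E) {m n : ℕ} (h : m ≤ n) : (T ^ m).ker ≤ (T ^ n).ker := by
  intro x hx
  have hx' : (T ^ m) x = 0 := hx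
  obtain ⟨k, rfl⟩ := Nat.exists_eq_add_of_le' h
  change (T ^ (k + m)) x = 0
  rw [pow_add_apply, hx', map_zero]

lemma range_pow_le_range_pow (T : E →L[ℂ] E) {m n : ℕ} (h : m ≤ n) :
    (T ^ n).range ≤ (T ^ m).range := by
  rintro _ ⟨x, rfl⟩
  obtain ⟨k, rfl⟩ := Nat.exists_eq_add_of_le h
  exact ⟨(T ^ k) x, (pow_add_apply T m k x).symm⟩

lemma ker_pow_eq_of_le {T : E →L[ℂ] E} {p n : ℕ} (h : (T ^ p).ker = (T ^ (p + 1)).ker)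
    (hn : p ≤ n) : (T ^ n).ker = (T ^ p).ker := by
  induction n, hn using Nat.le_induction with
  | base => rfl
  | succ n hn ih =>
    refine le_antisymm (fun x hx => ?_) (ker_pow_le_ker_pow T (by omega))
    have hx' : (T ^ n) (T x) = 0 := by
      have : (T ^ (n + 1)) x = 0 := hx
      rwa [pow_succ_apply] at this
    have h2 : T x ∈ (T ^ p).ker := ih ▸ (show T x ∈ (T ^ n).ker from hx')
    rw [h]
    change (T ^ (p + 1)) x = 0
    rw [pow_succ_apply]
    exact h2

lemma range_pow_eq_of_le {T : E →L[ℂ] E} {p n : ℕ} (h : (T ^ p).range = (T ^ (p + 1)).range)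
    (hn : p ≤ n) : (T ^ n).range = (T ^ p).range := by
  induction n, hn using Nat.le_induction with
  | base => rfl
  | succ n hn ih =>
    refine le_antisymm (range_pow_le_range_pow T (by omega)) (fun x hx => ?_)
    rw [h] at hx
    obtain ⟨y, rfl⟩ := hx
    have : (T ^ p) y ∈ (T ^ n).range := ih ▸ ⟨y, rfl⟩
    obtain ⟨w, hw⟩ := this
    refine ⟨w, ?_⟩
    have hw' : (T ^ n) w = (T ^ p) y := hw
    change (T ^ (n + 1)) w = (T ^ (p + 1)) y
    rw [pow_succ_apply', pow_succ_apply', hw']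

/-- A common exponent at which both the kernels and the ranges of the powers have stabilized
forces the ascent and the descent to agree. -/
lemma ascent_eq_descent_iff (T : E →L[ℂ] E) :
    (ascent T = descent T ∧ ascent T < ⊤) ↔
      ∃ p : ℕ, (T ^ p).ker = (T ^ (p + 1)).ker ∧ (T ^ p).range = (T ^ (p + 1)).range := by
  constructor
  · rintro ⟨h, ht⟩
    have key : ∀ s : Set ℕ, sInf ((fun n : ℕ => (n : ℕ∞)) '' s) < ⊤ →
        ∃ n ∈ s, (n : ℕ∞) = sInf ((fun n : ℕ => (n : ℕ∞)) '' s) := by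
      intro s hs
      have hne : ((fun n : ℕ => (n : ℕ∞)) '' s).Nonempty := by
        by_contra hne
        rw [Set.not_nonempty_iff_eq_empty] at hne
        simp [hne] at hs
      exact csInf_mem hne
    obtain ⟨a, ha, hae⟩ := key _ ht
    obtain ⟨d, hd, hde⟩ := key _ (h ▸ ht : descent T < ⊤)
    have : a = d := by
      have h' : (a : ℕ∞) = (d : ℕ∞) := hae.trans (h.trans hde.symm)
      exact_mod_cast h'
    subst this
    exact ⟨a, ha, hd⟩
  · rintro ⟨p, hk, hr⟩
    have hset : {n : ℕ | (T ^ n).ker = (T ^ (n + 1)).ker} =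
        {n : ℕ | (T ^ n).range = (T ^ (n + 1)).range} := by
      ext n
      constructor
      · intro hn
        refine le_antisymm ?_ (range_pow_le_range_pow T (by omega))
        rintro _ ⟨x, rfl⟩
        -- Push `T ^ n x` into the stable range and cancel, using that the kernels are stable.
        have h1 : (T ^ (p + n)) x ∈ (T ^ (p + n + 1)).range := by
          rw [range_pow_eq_of_le hr (by omega), ← range_pow_eq_of_le hr (by omega : p ≤ p + n)]
          exact ⟨x, rfl⟩
        obtain ⟨y, hy⟩ := h1
        have hy' : (T ^ (p + n + 1)) y = (T ^ (p + n)) x := hy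
        have h2 : x - T y ∈ (T ^ (p + n)).ker := by
          change (T ^ (p + n)) (x - T y) = 0
          rw [map_sub, ← hy', pow_succ_apply, sub_self]
        rw [ker_pow_eq_of_le hn (by omega)] at h2
        have h3 : (T ^ n) (x - T y) = 0 := h2
        refine ⟨y, ?_⟩
        change (T ^ (n + 1)) y = (T ^ n) x
        rw [map_sub, sub_eq_zero] at h3
        rw [h3, pow_succ_apply]
      · intro hn
        refine le_antisymm (ker_pow_le_ker_pow T (by omega)) ?_
        intro x hx
        have hx' : T ((T ^ n) x) = 0 := by
          have : (T ^ (n + 1)) x = 0 := hx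
          rwa [pow_succ_apply'] at this
        have h1 : (T ^ n) x ∈ (T ^ (p + n)).range := by
          rw [range_pow_eq_of_le hn (by omega)]
          exact ⟨x, rfl⟩
        obtain ⟨y, hy⟩ := h1
        have hy' : (T ^ (p + n)) y = (T ^ n) x := hy
        have h2 : y ∈ (T ^ (p + n + 1)).ker := by
          change (T ^ (p + n + 1)) y = 0
          rw [pow_succ_apply', hy', hx']
        rw [ker_pow_eq_of_le hk (by omega), ← ker_pow_eq_of_le hk (by omega : p ≤ p + n)] at h2
        change (T ^ n) x = 0
        rw [← hy']
        exact h2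
    refine ⟨?_, ?_⟩
    · rw [ascent, descent, hset]
    · refine lt_of_le_of_lt (sInf_le ⟨p, hk, rfl⟩) (ENat.natCast_lt_top p)

end FiniteAscentDescent

/-! ### Fredholm operators between Banach spaces -/

section ClosedRange

variable {E F : Type*} [NormedAddCommGroup E] [NormedSpace ℂ E] [CompleteSpace E]
  [NormedAddCommGroup F] [NormedSpace ℂ F] [CompleteSpace F]

/-- The range of a bounded operator between Banach spaces is closed as soon as it has a closed
algebraic complement. -/
lemma isClosed_range_of_isCompl (T : E →L[ℂ] F) {G : Submodule ℂ F} (h : IsCompl T.range G)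
    (hG : IsClosed (G : Set F)) : IsClosed (T.range : Set F) := by
  have : CompleteSpace G := hG.completeSpace_coe
  let π : E × G →L[ℂ] F := T.coprod G.subtypeL
  have hπ : ∀ x g, π (x, g) = T x + g := fun x g => rfl
  have hsurj : Function.Surjective π := by
    intro y
    have : y ∈ T.range ⊔ G := h.sup_eq_top ▸ Submodule.mem_top
    obtain ⟨_, ⟨x, rfl⟩, g, hg, rfl⟩ := Submodule.mem_sup.1 this
    exact ⟨(x, ⟨g, hg⟩), rfl⟩
  -- The complement of the range is the image of an open set under an open map.
  have heq : (T.range : Set F)ᶜ = π '' {q | q.2 ≠ 0} := by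
    ext y
    constructor
    · intro hy
      obtain ⟨⟨x, g⟩, rfl⟩ := hsurj y
      refine ⟨(x, g), ?_, rfl⟩
      rintro (rfl : g = 0)
      exact hy ⟨x, by simp [hπ]⟩
    · rintro ⟨⟨x, g⟩, hg, rfl⟩ ⟨x', hx'⟩
      have hx'' : T x' = T x + g := hx'
      have hgr : (g : F) ∈ T.range := ⟨x' - x, by simp [hx'']⟩
      exact hg (Subtype.ext (Submodule.disjoint_def.1 h.disjoint _ hgr g.2))
  rw [← isOpen_compl_iff, heq]
  exact π.isOpenMap hsurj _ (isOpen_ne.preimage continuous_snd)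

lemma isFredholm_iff_finiteDimensional (T : E →L[ℂ] F) :
    T.IsFredholm ↔ FiniteDimensional ℂ T.ker ∧ FiniteDimensional ℂ (F ⧸ T.range) := by
  constructor
  · intro h
    exact ⟨h.finite_ker, h.finite_coker⟩
  · rintro ⟨h₁, h₂⟩
    obtain ⟨C, hC⟩ := Submodule.exists_isCompl T.range
    have : FiniteDimensional ℂ C :=
      (Submodule.quotientEquivOfIsCompl _ _ hC).finiteDimensional
    have hcl : IsClosed (T.range : Set F) :=
      isClosed_range_of_isCompl T hC C.closed_of_finiteDimensional
    have : CompleteSpace T.range := hcl.completeSpace_coe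
    refine ⟨?_, hcl, h₁, h₂, Submodule.ClosedComplemented.of_finiteDimensional _⟩
    have hs : Function.Surjective T.rangeRestrict := by
      rintro ⟨_, x, rfl⟩
      exact ⟨x, rfl⟩
    exact T.rangeRestrict.isQuotientMap hs

end ClosedRange

/-! ### Weyl operators -/

section Weyl

variable {E : Type*} [NormedAddCommGroup E] [NormedSpace ℂ E] [CompleteSpace E]

lemma isWeyl_iff (T : E →L[ℂ] E) :
    IsWeyl T ↔ FiniteDimensional ℂ T.ker ∧ FiniteDimensional ℂ (E ⧸ T.range) ∧
      Module.finrank ℂ T.ker = Module.finrank ℂ (E ⧸ T.range) := by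
  rw [IsWeyl, isFredholm_iff_finiteDimensional, index, sub_eq_zero, Nat.cast_inj, and_assoc]

lemma isWeyl_of_bijective {T : E →L[ℂ] E} (h : Function.Bijective T) : IsWeyl T := by
  have hk : T.ker = ⊥ := LinearMap.ker_eq_bot.2 h.1
  have hr : T.range = ⊤ := LinearMap.range_eq_top.2 h.2
  rw [isWeyl_iff, hk, hr]
  refine ⟨inferInstance, inferInstance, ?_⟩
  rw [finrank_bot, Module.finrank_zero_of_subsingleton]

lemma IsWeyl.bijective_of_ker_eq_bot {T : E →L[ℂ] E} (h : IsWeyl T) (hk : T.ker = ⊥) :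
    Function.Bijective T := by
  obtain ⟨-, h₂, h₃⟩ := (isWeyl_iff T).1 h
  refine ⟨LinearMap.ker_eq_bot.1 hk, LinearMap.range_eq_top.1 ?_⟩
  rw [hk, finrank_bot] at h₃
  exact Submodule.Quotient.subsingleton_iff.1 (Module.finrank_zero_iff.1 h₃.symm)

/-- Being Weyl may be tested on a closed invariant subspace `M` when `T` acts bijectively
on the quotient by `M`. -/
lemma isWeyl_restrict_iff {T : E →L[ℂ] E} {M : Submodule ℂ E} (hM : IsClosed (M : Set E))
    (h : Set.MapsTo T M M) (h₁ : ∀ x, T x ∈ M → x ∈ M) (h₂ : ∀ y, ∃ x, y - T x ∈ M) :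
    IsWeyl (T.restrict h) ↔ IsWeyl T := by
  have : CompleteSpace M := hM.completeSpace_coe
  have e₁ := kerRestrictEquiv (T : E →ₗ[ℂ] E) h h₁
  have e₂ := cokerRestrictEquiv (T : E →ₗ[ℂ] E) h h₁ h₂
  rw [isWeyl_iff, isWeyl_iff]
  exact and_congr (Module.Finite.equiv_iff e₁) (and_congr (Module.Finite.equiv_iff e₂)
    (by rw [← e₁.finrank_eq, ← e₂.finrank_eq]; rfl))

/-- An operator that induces an isomorphism `E ⧸ M → E ⧸ N`, where `M` and `N` are finite
dimensional of the same dimension, is Weyl. -/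
lemma isWeyl_of_finiteDimensional {T : E →L[ℂ] E} {M N : Submodule ℂ E}
    [FiniteDimensional ℂ M] [FiniteDimensional ℂ N]
    (hMN : Module.finrank ℂ M = Module.finrank ℂ N)
    (h : ∀ x ∈ M, T x ∈ N) (h₁ : ∀ x, T x ∈ N → x ∈ M) (h₂ : ∀ y, ∃ x, y - T x ∈ N) :
    IsWeyl T := by
  have e₁ := kerRestrictEquiv (T : E →ₗ[ℂ] E) h h₁
  have e₂ := cokerRestrictEquiv (T : E →ₗ[ℂ] E) h h₁ h₂
  rw [isWeyl_iff]
  refine ⟨e₁.finiteDimensional, e₂.finiteDimensional, ?_⟩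
  rw [← e₁.finrank_eq, ← e₂.finrank_eq]
  have hk := ((T : E →ₗ[ℂ] E).restrict h).finrank_range_add_finrank_ker
  have hr := (LinearMap.range ((T : E →ₗ[ℂ] E).restrict h)).finrank_quotient_add_finrank
  omega

/-- The Weyl operators are the finite rank perturbations of the invertible operators. -/
lemma isWeyl_iff_exists_isUnit_add (T : E →L[ℂ] E) :
    IsWeyl T ↔ ∃ U F : E →L[ℂ] E, IsUnit U ∧ FiniteDimensional ℂ F.range ∧ T = U + F := by
  constructor
  · intro hT
    obtain ⟨h₁, h₂, h₃⟩ := (isWeyl_iff T).1 hT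
    obtain ⟨p, hp⟩ := hT.1.closedComplemented_ker
    obtain ⟨C, hC⟩ := Submodule.exists_isCompl T.range
    have eC := Submodule.quotientEquivOfIsCompl _ _ hC
    have : FiniteDimensional ℂ C := eC.finiteDimensional
    let e : T.ker ≃ₗ[ℂ] C := LinearEquiv.ofFinrankEq _ _ (h₃.trans eC.finrank_eq)
    -- `F` identifies the kernel of `T` with a complement of its range, so `T + F` is invertible.
    let F : E →L[ℂ] E := C.subtypeL ∘L (LinearMap.toContinuousLinearMap (e : T.ker →ₗ[ℂ] C)) ∘L p
    have hF : ∀ x, F x = (e (p x) : E) := fun x => rfl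
    have hFr : F.range ≤ C := by
      rintro _ ⟨x, rfl⟩
      exact (e (p x)).2
    refine ⟨T + F, -F, ?_, ?_, by simp⟩
    · rw [ContinuousLinearMap.isUnit_iff_bijective]
      constructor
      · rw [injective_iff_map_eq_zero]
        intro x hx
        have hx' : T x + (e (p x) : E) = 0 := hx
        have hc : (e (p x) : E) = 0 := by
          refine Submodule.disjoint_def.1 hC.disjoint _ ⟨-x, ?_⟩ (e (p x)).2
          change T (-x) = _
          rw [map_neg, neg_eq_iff_add_eq_zero, hx']
        have hk : T x = 0 := by rwa [hc, add_zero] at hx'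
        have hpx : p x = ⟨x, hk⟩ := hp ⟨x, hk⟩
        have hpx0 : p x = 0 := e.map_eq_zero_iff.1 (Subtype.ext hc)
        rw [hpx] at hpx0
        exact congrArg Subtype.val hpx0
      · intro y
        have hy : y ∈ T.range ⊔ C := hC.sup_eq_top ▸ Submodule.mem_top
        obtain ⟨_, ⟨x, rfl⟩, c, hc, rfl⟩ := Submodule.mem_sup.1 hy
        refine ⟨x - (p x : E) + (e.symm ⟨c, hc⟩ : E), ?_⟩
        have hk : ∀ z : T.ker, T z = 0 := fun z => z.2
        change T _ + (e (p _) : E) = T x + c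
        rw [map_add, map_sub, map_add, map_sub, hk, hk, hp, hp]
        simp
    · have : (-F).range ≤ C := by
        rintro _ ⟨x, rfl⟩
        exact C.neg_mem (e (p x)).2
      exact Submodule.finiteDimensional_of_le this
  · rintro ⟨U, F, hU, hF, rfl⟩
    obtain ⟨hUi, hUs⟩ := ContinuousLinearMap.isUnit_iff_bijective.1 hU
    let e := LinearEquiv.ofBijective (U : E →ₗ[ℂ] E) ⟨hUi, hUs⟩
    have e' : F.range.map (e.symm : E →ₗ[ℂ] E) ≃ₗ[ℂ] F.range := (e.symm.submoduleMap F.range).symm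
    have hmem : ∀ x, x ∈ F.range.map (e.symm : E →ₗ[ℂ] E) ↔ U x ∈ F.range := by
      intro x
      rw [Submodule.mem_map_equiv]
      rfl
    have : FiniteDimensional ℂ (F.range.map (e.symm : E →ₗ[ℂ] E)) := e'.symm.finiteDimensional
    have hFx : ∀ x, F x ∈ F.range := fun x => ⟨x, rfl⟩
    refine isWeyl_of_finiteDimensional e'.finrank_eq ?_ ?_ ?_
    · intro x hx
      exact F.range.add_mem ((hmem x).1 hx) (hFx x)
    · intro x hx
      rw [hmem]
      exact (F.range.add_mem_iff_left (hFx x)).1 hx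
    · intro y
      obtain ⟨x, rfl⟩ := hUs y
      refine ⟨x, ?_⟩
      rw [add_apply, sub_add_cancel_left]
      exact F.range.neg_mem (hFx x)

lemma IsWeyl.mul {S T : E →L[ℂ] E} (hS : IsWeyl S) (hT : IsWeyl T) : IsWeyl (S * T) := by
  rw [isWeyl_iff_exists_isUnit_add] at hS hT ⊢
  obtain ⟨U, F, hU, hF, rfl⟩ := hS
  obtain ⟨U', F', hU', hF', rfl⟩ := hT
  refine ⟨U * U', U * F' + F * (U' + F'), hU.mul hU', ?_, by noncomm_ring⟩
  have hle : (U * F' + F * (U' + F')).range ≤ F'.range.map (U : E →ₗ[ℂ] E) ⊔ F.range := by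
    rintro _ ⟨x, rfl⟩
    exact Submodule.add_mem_sup ⟨F' x, ⟨x, rfl⟩, rfl⟩ ⟨_, rfl⟩
  exact Submodule.finiteDimensional_of_le hle

lemma isWeyl_one : IsWeyl (1 : E →L[ℂ] E) := isWeyl_of_bijective Function.bijective_id

lemma IsWeyl.pow {T : E →L[ℂ] E} (hT : IsWeyl T) (n : ℕ) : IsWeyl (T ^ n) := by
  induction n with
  | zero => rw [pow_zero]; exact isWeyl_one
  | succ n ih => rw [pow_succ]; exact ih.mul hT

/-- The Weyl operators are stable under small scalar perturbations. -/
lemma IsWeyl.eventually_shift {T : E →L[ℂ] E} (hT : IsWeyl T) :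
    ∀ᶠ z in nhds (0 : ℂ), IsWeyl (shift T z) := by
  obtain ⟨U, F, hU, hF, rfl⟩ := (isWeyl_iff_exists_isUnit_add T).1 hT
  have hc : Continuous fun z : ℂ => U - z • (1 : E →L[ℂ] E) := by fun_prop
  have ho : {z : ℂ | IsUnit (U - z • (1 : E →L[ℂ] E))} ∈ nhds 0 :=
    (Units.isOpen.preimage hc).mem_nhds (by simpa using hU)
  filter_upwards [ho] with z hz
  refine (isWeyl_iff_exists_isUnit_add _).2 ⟨_, F, hz, hF, ?_⟩
  rw [shift]
  abel

end Weyl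

/-! ### Drazin invertible operators -/

section Drazin

variable {E : Type*} [NormedAddCommGroup E] [NormedSpace ℂ E]

lemma shift_apply (T : E →L[ℂ] E) (z : ℂ) (x : E) : shift T z x = T x - z • x := rfl

lemma restrictRangePow_apply (T : E →L[ℂ] E) (n : ℕ) (x : (T ^ n).range) :
    (restrictRangePow T n x : E) = T x := rfl

/-- The kernels and the ranges of the powers of `T` are stable from `p` on precisely when `T`
acts bijectively on `R(T ^ p)`. -/
lemma bijective_restrictRangePow_iff (T : E →L[ℂ] E) (p : ℕ) :
    Function.Bijective (restrictRangePow T p) ↔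
      (T ^ p).ker = (T ^ (p + 1)).ker ∧ (T ^ p).range = (T ^ (p + 1)).range := by
  constructor
  · rintro ⟨hi, hs⟩
    refine ⟨le_antisymm (ker_pow_le_ker_pow T (by omega)) fun x hx => ?_,
      le_antisymm (fun y hy => ?_) (range_pow_le_range_pow T (by omega))⟩
    · have hx' : (T ^ (p + 1)) x = 0 := hx
      have h0 : restrictRangePow T p ⟨(T ^ p) x, x, rfl⟩ = 0 :=
        Subtype.ext (by rw [restrictRangePow_apply, ← pow_succ_apply', hx']; rfl)
      exact congrArg Subtype.val ((injective_iff_map_eq_zero _).1 hi _ h0)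
    · obtain ⟨⟨_, x, rfl⟩, hx⟩ := hs ⟨y, hy⟩
      exact ⟨x, (pow_succ_apply' T p x).trans (congrArg Subtype.val hx)⟩
  · rintro ⟨hk, hr⟩
    refine ⟨(injective_iff_map_eq_zero _).2 ?_, ?_⟩
    · rintro ⟨_, x, rfl⟩ hx
      have hx' : (T ^ (p + 1)) x = 0 := (pow_succ_apply' T p x).trans (congrArg Subtype.val hx)
      have : x ∈ (T ^ p).ker := hk ▸ hx'
      exact Subtype.ext this
    · rintro ⟨y, hy⟩
      have hy' := hy
      rw [hr] at hy'
      obtain ⟨x, hx⟩ := hy'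
      exact ⟨⟨(T ^ p) x, x, rfl⟩, Subtype.ext ((pow_succ_apply' T p x).symm.trans hx)⟩

/-- The Fitting decomposition. -/
lemma isCompl_range_ker_pow {T : E →L[ℂ] E} {p : ℕ} (hk : (T ^ p).ker = (T ^ (p + 1)).ker)
    (hr : (T ^ p).range = (T ^ (p + 1)).range) : IsCompl (T ^ p).range (T ^ p).ker := by
  have hk2 : (T ^ (p + p)).ker = (T ^ p).ker := ker_pow_eq_of_le hk (by omega)
  have hr2 : (T ^ (p + p)).range = (T ^ p).range := range_pow_eq_of_le hr (by omega)
  refine ⟨Submodule.disjoint_def.2 ?_, codisjoint_iff.2 (eq_top_iff.2 fun x _ => ?_)⟩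
  · rintro _ ⟨x, rfl⟩ hx
    have : x ∈ (T ^ (p + p)).ker := (pow_add_apply T p p x).trans hx
    rw [hk2] at this
    exact this
  · have hx : (T ^ p) x ∈ (T ^ (p + p)).range := hr2 ▸ ⟨x, rfl⟩
    obtain ⟨y, hy⟩ := hx
    have hy' : (T ^ p) ((T ^ p) y) = (T ^ p) x := (pow_add_apply T p p y).symm.trans hy
    refine Submodule.mem_sup.2 ⟨(T ^ p) y, ⟨y, rfl⟩, x - (T ^ p) y, ?_, by abel⟩
    change (T ^ p) (x - (T ^ p) y) = 0
    rw [map_sub, hy', sub_self]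

lemma IsDrazinInvertible.exists_stable {T : E →L[ℂ] E} (h : IsDrazinInvertible T) :
    ∃ p : ℕ, (T ^ p).ker = (T ^ (p + 1)).ker ∧ (T ^ p).range = (T ^ (p + 1)).range := by
  obtain ⟨S, m, h₁, -, h₃⟩ := h
  have hTS : Commute T S := h₃
  have e₁ : T ^ m = S * T ^ (m + 1) := by
    rw [pow_succ, ← mul_assoc, ← (hTS.pow_left m).eq, ← h₁]
  have e₂ : T ^ m = T ^ (m + 1) * S := by
    rw [pow_succ, mul_assoc, h₃, ← mul_assoc, ← h₁]
  refine ⟨m, le_antisymm (ker_pow_le_ker_pow T (by omega)) fun x hx => ?_,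
    le_antisymm ?_ (range_pow_le_range_pow T (by omega))⟩
  · have hx' : (T ^ (m + 1)) x = 0 := hx
    change (T ^ m) x = 0
    have := congrArg (fun R : E →L[ℂ] E => R x) e₁
    exact this.trans ((congrArg S hx').trans (map_zero S))
  · rintro _ ⟨x, rfl⟩
    exact ⟨S x, (congrArg (fun R : E →L[ℂ] E => R x) e₂).symm⟩

variable [CompleteSpace E]

lemma isClosed_range_pow_of_stable {T : E →L[ℂ] E} {p : ℕ}
    (hk : (T ^ p).ker = (T ^ (p + 1)).ker) (hr : (T ^ p).range = (T ^ (p + 1)).range) :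
    IsClosed ((T ^ p).range : Set E) :=
  isClosed_range_of_isCompl _ (isCompl_range_ker_pow hk hr) (T ^ p).isClosed_ker

/-- Drazin invertible operators are those with finite ascent and descent. -/
lemma isDrazinInvertible_iff_exists_stable (T : E →L[ℂ] E) :
    IsDrazinInvertible T ↔
      ∃ p : ℕ, (T ^ p).ker = (T ^ (p + 1)).ker ∧ (T ^ p).range = (T ^ (p + 1)).range := by
  refine ⟨IsDrazinInvertible.exists_stable, ?_⟩
  rintro ⟨p, hk, hr⟩
  have : CompleteSpace (T ^ p).range := (isClosed_range_pow_of_stable hk hr).completeSpace_coe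
  obtain ⟨τ, hτ⟩ := ContinuousLinearMap.isUnit_iff_bijective.2
    ((bijective_restrictRangePow_iff T p).2 ⟨hk, hr⟩)
  let q : E →L[ℂ] (T ^ p).range := (T ^ p).rangeRestrict
  let σ : (T ^ p).range →L[ℂ] (T ^ p).range := ↑τ⁻¹
  let t : (T ^ p).range →L[ℂ] (T ^ p).range := ↑τ
  have hts : Commute t σ := by
    change t * σ = σ * t
    rw [Units.mul_inv, Units.inv_mul]
  have hιt : ∀ v, ((t v : (T ^ p).range) : E) = T v := fun v => by
    change (((τ : (T ^ p).range →L[ℂ] (T ^ p).range) v : (T ^ p).range) : E) = T v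
    rw [hτ, restrictRangePow_apply]
  have hιtn : ∀ (n : ℕ) v, (((t ^ n) v : (T ^ p).range) : E) = (T ^ n) v := by
    intro n
    induction n with
    | zero => intro v; rfl
    | succ n ih => intro v; rw [pow_succ_apply', pow_succ_apply', hιt, ih]
  have hqT : ∀ x, q (T x) = t (q x) := fun x => Subtype.ext (by
    rw [hιt]
    exact (pow_succ_apply T p x).symm.trans (pow_succ_apply' T p x))
  have hqι : ∀ v : (T ^ p).range, q v = (t ^ p) v := fun v => Subtype.ext (hιtn p v).symm
  have htσ : ∀ v, t (σ v) = v := fun v =>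
    congrArg (fun R : (T ^ p).range →L[ℂ] (T ^ p).range => R v) τ.mul_inv
  have hσt : ∀ v, σ (t v) = v := fun v =>
    congrArg (fun R : (T ^ p).range →L[ℂ] (T ^ p).range => R v) τ.inv_mul
  have hpow : ∀ v, (t ^ p) ((σ ^ p) v) = v := fun v => by
    have h1 : t ^ p * σ ^ p = 1 := by
      rw [← hts.mul_pow, show t * σ = 1 from τ.mul_inv, one_pow]
    exact congrArg (fun R : (T ^ p).range →L[ℂ] (T ^ p).range => R v) h1
  have hpow' : ∀ v, (σ ^ p) ((t ^ p) v) = v := fun v => by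
    have h1 : σ ^ p * t ^ p = 1 := by
      rw [← hts.symm.mul_pow, show σ * t = 1 from τ.inv_mul, one_pow]
    exact congrArg (fun R : (T ^ p).range →L[ℂ] (T ^ p).range => R v) h1
  -- With `t` the restriction of `T` to `R(T ^ p)`, the Drazin inverse is `t⁻¹ ^ (p + 1) T ^ p`.
  let S : E →L[ℂ] E := (T ^ p).range.subtypeL ∘L (σ ^ (p + 1)) ∘L q
  have hS : ∀ x, S x = ((σ ^ (p + 1)) (q x) : (T ^ p).range) := fun x => rfl
  have hST : ∀ x, S (T x) = ((σ ^ p) (q x) : (T ^ p).range) := fun x => by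
    rw [hS, hqT, pow_succ_apply, hσt]
  have hTS : ∀ x, T (S x) = ((σ ^ p) (q x) : (T ^ p).range) := fun x => by
    rw [hS, ← hιt, pow_succ_apply', htσ]
  refine ⟨S, p, ?_, ?_, ?_⟩
  · ext x
    change (T ^ p) x = (T ^ p) (S (T x))
    rw [hST, ← hιtn, hpow]
    rfl
  · ext x
    change S (T (S x)) = S x
    rw [hST, hS, hqι, hpow']
  · ext x
    change T (S x) = S (T x)
    rw [hTS, hST]

lemma mem_poles_iff (T : E →L[ℂ] E) (z : ℂ) : z ∈ poles T ↔ IsDrazinInvertible (shift T z) := by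
  rw [isDrazinInvertible_iff_exists_stable, ← ascent_eq_descent_iff]
  rfl

lemma isDrazinInvertible_of_bijective {T : E →L[ℂ] E} (h : Function.Bijective T) :
    IsDrazinInvertible T := by
  obtain ⟨u, rfl⟩ := ContinuousLinearMap.isUnit_iff_bijective.2 h
  exact ⟨↑u⁻¹, 0, by simp, by simp, by simp⟩

lemma IsDrazinInvertible.isBWeyl {T : E →L[ℂ] E} (h : IsDrazinInvertible T) : IsBWeyl T := by
  obtain ⟨p, hk, hr⟩ := h.exists_stable
  have hcl := isClosed_range_pow_of_stable hk hr
  have : CompleteSpace (T ^ p).range := hcl.completeSpace_coe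
  exact ⟨p, hcl, isWeyl_of_bijective ((bijective_restrictRangePow_iff T p).2 ⟨hk, hr⟩)⟩

lemma IsWeyl.isBWeyl {T : E →L[ℂ] E} (h : IsWeyl T) : IsBWeyl T := by
  have htop : (T ^ 0).range = ⊤ := by
    rw [pow_zero]
    exact LinearMap.range_id
  have hcl : IsClosed ((T ^ 0).range : Set E) := by
    rw [htop]
    exact isClosed_univ
  exact ⟨0, hcl, (isWeyl_restrict_iff hcl (mapsTo_range_pow T 0)
    (fun x _ => htop ▸ Submodule.mem_top) (fun y => ⟨0, htop ▸ Submodule.mem_top⟩)).2 h⟩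

/-- A Drazin invertible operator with finite dimensional kernel is Weyl. -/
lemma IsDrazinInvertible.isWeyl {T : E →L[ℂ] E} (h : IsDrazinInvertible T)
    [FiniteDimensional ℂ T.ker] : IsWeyl T := by
  obtain ⟨p, hk, hr⟩ := h.exists_stable
  have hfin : ∀ n : ℕ, FiniteDimensional ℂ (T ^ n).ker := by
    intro n
    induction n with
    | zero =>
      rw [pow_zero, show (1 : E →L[ℂ] E).ker = ⊥ from LinearMap.ker_id]
      infer_instance
    | succ n ih =>
      -- `T ^ n` maps `N(T ^ (n + 1))` to `N(T)` with kernel `N(T ^ n)`.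
      have hm : (T ^ (n + 1)).ker.map ((T ^ n : E →L[ℂ] E) : E →ₗ[ℂ] E) ≤ T.ker := by
        rintro _ ⟨x, hx, rfl⟩
        exact (pow_succ_apply' T n x).symm.trans hx
      rw [← Submodule.fg_iff_finiteDimensional]
      refine Submodule.fg_of_fg_map_of_fg_inf_ker ((T ^ n : E →L[ℂ] E) : E →ₗ[ℂ] E) ?_ ?_
      · exact (Submodule.fg_iff_finiteDimensional _).2 (Submodule.finiteDimensional_of_le hm)
      · exact (Submodule.fg_iff_finiteDimensional _).2
          (Submodule.finiteDimensional_of_le inf_le_right)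
  have := hfin p
  have hbij := (bijective_restrictRangePow_iff T p).2 ⟨hk, hr⟩
  refine isWeyl_of_finiteDimensional (M := (T ^ p).ker) (N := (T ^ p).ker) rfl ?_ ?_ ?_
  · intro x hx
    rw [hk] at hx
    exact (pow_succ_apply T p x).symm.trans hx
  · intro x hx
    rw [hk]
    exact (pow_succ_apply T p x).trans hx
  · intro y
    have hy : (T ^ p) y ∈ (T ^ (p + 1)).range := hr ▸ ⟨y, rfl⟩
    obtain ⟨x, hx⟩ := hy
    have hx' : (T ^ p) (T x) = (T ^ p) y := (pow_succ_apply T p x).symm.trans hx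
    refine ⟨x, ?_⟩
    change (T ^ p) (y - T x) = 0
    rw [map_sub, hx', sub_self]

end Drazin

/-! ### Reformulation of Browder's theorem -/

section SpectralBasics

variable {E : Type*} [NormedAddCommGroup E] [NormedSpace ℂ E]

lemma shift_shift (T : E →L[ℂ] E) (z w : ℂ) : shift (shift T z) w = shift T (z + w) := by
  rw [shift, shift, shift, add_smul, sub_sub]

lemma mem_spectrum_iff [CompleteSpace E] (T : E →L[ℂ] E) (z : ℂ) :
    z ∈ spectrum ℂ T ↔ ¬ Function.Bijective (shift T z) := by
  rw [spectrum.mem_iff, ← ContinuousLinearMap.isUnit_iff_bijective, shift,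
    Algebra.algebraMap_eq_smul_one, ← IsUnit.neg_iff, neg_sub]

lemma mem_finiteRankPoles_iff [CompleteSpace E] (T : E →L[ℂ] E) (z : ℂ) :
    z ∈ finiteRankPoles T ↔
      IsDrazinInvertible (shift T z) ∧ FiniteDimensional ℂ (shift T z).ker := by
  rw [← mem_poles_iff]
  rfl

/-- One inclusion of Browder's theorem always holds, so that only the other one matters. -/
lemma browdersTheorem_iff [CompleteSpace E] (T : E →L[ℂ] E) :
    BrowdersTheorem T ↔ ∀ z, IsWeyl (shift T z) → IsDrazinInvertible (shift T z) := by
  constructor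
  · intro h z hz
    have hz' : z ∉ spectrum ℂ T \ finiteRankPoles T := by
      rw [← h]
      exact not_not.2 hz
    by_cases hb : Function.Bijective (shift T z)
    · exact isDrazinInvertible_of_bijective hb
    · by_contra hd
      exact hz' ⟨(mem_spectrum_iff T z).2 hb, fun hp => hd ((mem_finiteRankPoles_iff T z).1 hp).1⟩
  · intro h
    ext z
    constructor
    · intro hz
      refine ⟨(mem_spectrum_iff T z).2 fun hb => hz (isWeyl_of_bijective hb), fun hp => hz ?_⟩
      obtain ⟨hd, hf⟩ := (mem_finiteRankPoles_iff T z).1 hp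
      exact hd.isWeyl
    · rintro ⟨-, hp⟩ hw
      exact hp ((mem_finiteRankPoles_iff T z).2 ⟨h z hw, hw.1.finite_ker⟩)

end SpectralBasics

/-! ### Operators with large kernels -/

section LargeKernels

variable {E : Type*} [NormedAddCommGroup E] [NormedSpace ℂ E]

/-- An operator has large kernels if the kernel of each induced operator `T_n` is either trivial or
infinite dimensional. -/
def HasLargeKernels (T : E →L[ℂ] E) : Prop :=
  ∀ n : ℕ, FiniteDimensional ℂ ↥(T.ker ⊓ (T ^ n).range) → T.ker ⊓ (T ^ n).range = ⊥

/-- For an operator with large kernels, an induced operator that is Fredholm of index zero has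
trivial kernel, hence trivial cokernel. -/
lemma HasLargeKernels.isDrazinInvertible [CompleteSpace E] {T : E →L[ℂ] E}
    (hT : HasLargeKernels T) (h : IsBWeyl T) : IsDrazinInvertible T := by
  obtain ⟨n, hcl, hw⟩ := h
  have : CompleteSpace (T ^ n).range := hcl.completeSpace_coe
  have hw' : IsWeyl (restrictRangePow T n) := hw
  have hfin : FiniteDimensional ℂ (restrictRangePow T n).ker := hw'.1.finite_ker
  let j : ↥(T.ker ⊓ (T ^ n).range) →ₗ[ℂ] (restrictRangePow T n).ker :=
    { toFun := fun x => ⟨⟨x.1, x.2.2⟩, Subtype.ext x.2.1⟩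
      map_add' := fun _ _ => rfl
      map_smul' := fun _ _ => rfl }
  have hj : Function.Injective j := fun x y hxy =>
    Subtype.ext (congrArg (fun w : (restrictRangePow T n).ker => ((w : (T ^ n).range) : E)) hxy)
  have hbot := hT n (FiniteDimensional.of_injective j hj)
  have hk : (restrictRangePow T n).ker = ⊥ := by
    rw [eq_bot_iff]
    intro x hx
    have hx' : (x : E) ∈ T.ker ⊓ (T ^ n).range := ⟨congrArg Subtype.val hx, x.2⟩
    rw [hbot] at hx'
    exact Subtype.ext hx'
  rw [isDrazinInvertible_iff_exists_stable]
  exact ⟨n, (bijective_restrictRangePow_iff T n).1 (hw'.bijective_of_ker_eq_bot hk)⟩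

lemma browdersTheorem_of_hasLargeKernels [CompleteSpace E] {T : E →L[ℂ] E}
    (hT : ∀ z, HasLargeKernels (shift T z)) : BrowdersTheorem T :=
  (browdersTheorem_iff T).2 fun z hz => (hT z).isDrazinInvertible hz.isBWeyl

lemma bWeylSpectrum_subset_drazinSpectrum [CompleteSpace E] (T : E →L[ℂ] E) :
    bWeylSpectrum T ⊆ drazinSpectrum T := fun _ hz hd => hz hd.isBWeyl

lemma bWeylSpectrum_eq_drazinSpectrum_iff [CompleteSpace E] (T : E →L[ℂ] E) :
    bWeylSpectrum T = drazinSpectrum T ↔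
      ∀ z, IsBWeyl (shift T z) → IsDrazinInvertible (shift T z) := by
  constructor
  · intro h z hz
    by_contra hd
    have : z ∈ bWeylSpectrum T := h ▸ hd
    exact this hz
  · intro h
    exact (bWeylSpectrum_subset_drazinSpectrum T).antisymm fun z hz hw => hz (h z hw)

end LargeKernels

/-! ### Multiplication operators -/

section Multiplication

variable {X : Type*} [NormedAddCommGroup X] [NormedSpace ℂ X]

lemma leftMul_apply (A B : X →L[ℂ] X) : leftMul A B = A * B := rfl

lemma rightMul_apply (A B : X →L[ℂ] X) : rightMul A B = B * A := rfl

lemma shift_leftMul (A : X →L[ℂ] X) (z : ℂ) : shift (leftMul A) z = leftMul (shift A z) := by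
  refine ContinuousLinearMap.ext fun B => ?_
  rw [shift_apply, leftMul_apply, leftMul_apply, shift, sub_mul, smul_one_mul]

lemma shift_rightMul (A : X →L[ℂ] X) (z : ℂ) : shift (rightMul A) z = rightMul (shift A z) := by
  refine ContinuousLinearMap.ext fun B => ?_
  rw [shift_apply, rightMul_apply, rightMul_apply, shift, mul_sub, mul_smul_one]

lemma leftMul_pow_apply (A : X →L[ℂ] X) (n : ℕ) (B : X →L[ℂ] X) :
    (leftMul A ^ n) B = A ^ n * B := by
  induction n generalizing B with
  | zero => rw [pow_zero, pow_zero, one_mul]; rfl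
  | succ n ih => rw [pow_succ_apply, ih, leftMul_apply, pow_succ, mul_assoc]

lemma rightMul_pow_apply (A : X →L[ℂ] X) (n : ℕ) (B : X →L[ℂ] X) :
    (rightMul A ^ n) B = B * A ^ n := by
  induction n generalizing B with
  | zero => rw [pow_zero, pow_zero, mul_one]; rfl
  | succ n ih => rw [pow_succ_apply, ih, rightMul_apply, pow_succ', mul_assoc]

lemma not_finiteDimensional_strongDual (hX : ¬ FiniteDimensional ℂ X) :
    ¬ FiniteDimensional ℂ (StrongDual ℂ X) := by
  intro h
  have h2 : FiniteDimensional ℂ (StrongDual ℂ X →ₗ[ℂ] ℂ) := inferInstance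
  refine hX (FiniteDimensional.of_injective
    (ContinuousLinearMap.coeLMₛₗ (RingHom.id ℂ) ∘ₗ
      (NormedSpace.inclusionInDoubleDual ℂ X : X →ₗ[ℂ] StrongDual ℂ (StrongDual ℂ X))) ?_)
  exact ContinuousLinearMap.coe_injective.comp
    (NormedSpace.inclusionInDoubleDualLi ℂ (E := X)).injective

/-- If `A B = 0` with `B = A ^ n C` and `B v ≠ 0`, the operators `f(·) B v` form an infinite
dimensional space of such products. -/
lemma hasLargeKernels_leftMul (hX : ¬ FiniteDimensional ℂ X) (A : X →L[ℂ] X) :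
    HasLargeKernels (leftMul A) := by
  intro n hfin
  by_contra hne
  obtain ⟨B, ⟨hB, C, hC⟩, hB0⟩ := Submodule.exists_mem_ne_zero_of_ne_bot hne
  have hB' : A * B = 0 := hB
  have hC' : A ^ n * C = B := (leftMul_pow_apply A n C).symm.trans hC
  obtain ⟨v, hv⟩ : ∃ v, B v ≠ 0 := by
    by_contra! h
    exact hB0 (ContinuousLinearMap.ext h)
  let φ : StrongDual ℂ X →ₗ[ℂ] ↥((leftMul A).ker ⊓ ((leftMul A) ^ n).range) :=
    { toFun := fun f => ⟨f.smulRight (B v), by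
        change leftMul A (f.smulRight (B v)) = 0
        ext x
        have : A (B v) = 0 := congrArg (fun R : X →L[ℂ] X => R v) hB'
        simp [leftMul_apply, this], f.smulRight (C v), by
        change (leftMul A ^ n) (f.smulRight (C v)) = f.smulRight (B v)
        rw [leftMul_pow_apply]
        ext x
        have : (A ^ n) (C v) = B v := congrArg (fun R : X →L[ℂ] X => R v) hC'
        change (A ^ n) (f x • C v) = f x • B v
        rw [map_smul, this]⟩
      map_add' := fun f g => Subtype.ext (by ext x; simp [add_smul])
      map_smul' := fun c f => Subtype.ext (by ext x; simp [mul_smul]) }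
  have hφ : Function.Injective φ := by
    rw [injective_iff_map_eq_zero]
    intro f hf
    ext x
    have h1 : f x • B v = 0 := congrArg (fun R : X →L[ℂ] X => R x) (congrArg Subtype.val hf)
    exact (smul_eq_zero.1 h1).resolve_right hv
  exact not_finiteDimensional_strongDual hX (FiniteDimensional.of_injective φ hφ)

/-- If `B A = 0` with `B = C A ^ n` and `f ∘ B ≠ 0`, the operators `f(B ·) y` form an infinite
dimensional space of such products. -/
lemma hasLargeKernels_rightMul (hX : ¬ FiniteDimensional ℂ X) (A : X →L[ℂ] X) :
    HasLargeKernels (rightMul A) := by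
  intro n hfin
  by_contra hne
  obtain ⟨B, ⟨hB, C, hC⟩, hB0⟩ := Submodule.exists_mem_ne_zero_of_ne_bot hne
  have hB' : B * A = 0 := hB
  have hC' : C * A ^ n = B := (rightMul_pow_apply A n C).symm.trans hC
  obtain ⟨v, hv⟩ : ∃ v, B v ≠ 0 := by
    by_contra! h
    exact hB0 (ContinuousLinearMap.ext h)
  obtain ⟨f, hf⟩ := SeparatingDual.exists_ne_zero (R := ℂ) hv
  let φ : X →ₗ[ℂ] ↥((rightMul A).ker ⊓ ((rightMul A) ^ n).range) :=
    { toFun := fun y => ⟨(f ∘L B).smulRight y, by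
        change rightMul A ((f ∘L B).smulRight y) = 0
        ext x
        have : B (A x) = 0 := congrArg (fun R : X →L[ℂ] X => R x) hB'
        simp [rightMul_apply, this], (f ∘L C).smulRight y, by
        change (rightMul A ^ n) ((f ∘L C).smulRight y) = (f ∘L B).smulRight y
        rw [rightMul_pow_apply]
        ext x
        have : C ((A ^ n) x) = B x := congrArg (fun R : X →L[ℂ] X => R x) hC'
        change f (C ((A ^ n) x)) • y = f (B x) • y
        rw [this]⟩
      map_add' := fun y z => Subtype.ext (by ext x; simp)
      map_smul' := fun c y => Subtype.ext (by ext x; simp [smul_comm c]) }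
  have hφ : Function.Injective φ := by
    rw [injective_iff_map_eq_zero]
    intro y hy
    have h1 : f (B v) • y = 0 := congrArg (fun R : X →L[ℂ] X => R v) (congrArg Subtype.val hy)
    exact (smul_eq_zero.1 h1).resolve_left hf
  exact hX (FiniteDimensional.of_injective φ hφ)

/-- A Drazin inverse of `a` commutes with everything that commutes with `a`. -/
lemma commute_drazinInverse {R : Type*} [Ring R] {a s b : R} {m : ℕ} (h₁ : a ^ m = a ^ m * s * a)
    (h₂ : s * a * s = s) (h₃ : a * s = s * a) (hb : Commute b a) : Commute b s := by
  have has : Commute a s := h₃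
  -- The idempotent `e = a s` factors through `a ^ m` on both sides.
  have he : (a * s) * (a * s) = a * s := by
    rw [mul_assoc, ← mul_assoc s, h₂]
  have hpow : ∀ k, (a * s) ^ (k + 1) = a * s := by
    intro k
    induction k with
    | zero => rw [zero_add, pow_one]
    | succ k ih => rw [pow_succ, ih, he]
  have hem : a * s = a ^ (m + 1) * s ^ (m + 1) := by rw [← has.mul_pow, hpow]
  have hem' : a * s = s ^ (m + 1) * a ^ (m + 1) := by
    rw [hem, (has.pow_pow (m + 1) (m + 1)).eq]
  have h1 : a ^ (m + 1) * (a * s) = a ^ (m + 1) := by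
    rw [h₃, pow_succ', mul_assoc, ← mul_assoc (a ^ m), ← h₁]
  have hc : Commute (a * s) (a ^ (m + 1)) :=
    ((Commute.refl a).mul_left has.symm).pow_right (m + 1)
  have h2 : (a * s) * a ^ (m + 1) = a ^ (m + 1) := hc.eq.trans h1
  have hbm : b * a ^ (m + 1) = a ^ (m + 1) * b := (hb.pow_right (m + 1)).eq
  have hbe : b * (a * s) = (a * s) * b * (a * s) := by
    calc b * (a * s) = a ^ (m + 1) * b * s ^ (m + 1) := by rw [hem, ← mul_assoc, hbm]
      _ = (a * s) * (a ^ (m + 1) * b * s ^ (m + 1)) := by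
        rw [← mul_assoc, ← mul_assoc, h2]
      _ = (a * s) * (b * (a * s)) := by rw [← hbm, mul_assoc b, ← hem]
      _ = _ := by rw [← mul_assoc]
  have heb : (a * s) * b = (a * s) * b * (a * s) := by
    calc (a * s) * b = s ^ (m + 1) * (a ^ (m + 1) * b) := by rw [hem', mul_assoc]
      _ = s ^ (m + 1) * (b * a ^ (m + 1)) := by rw [hbm]
      _ = s ^ (m + 1) * (b * (a ^ (m + 1) * (a * s))) := by rw [h1]
      _ = s ^ (m + 1) * (a ^ (m + 1) * b) * (a * s) := by
        rw [← hbm]; simp only [mul_assoc]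
      _ = _ := by rw [← mul_assoc (s ^ (m + 1)), ← hem']
  have hcomm : b * (a * s) = (a * s) * b := hbe.trans heb.symm
  have hes : (a * s) * s = s := by rw [h₃, h₂]
  have hse : s * (a * s) = s := by rw [← mul_assoc, h₂]
  calc b * s = b * ((a * s) * s) := by rw [hes]
    _ = (s * a) * b * s := by rw [← mul_assoc, hcomm, h₃]
    _ = s * (b * (a * s)) := by rw [mul_assoc s a b, ← hb.eq]; simp only [mul_assoc]
    _ = s * (a * s) * b := by rw [hcomm, ← mul_assoc]
    _ = s * b := by rw [hse]

/-- The Drazin inverse of `L_A` commutes with all right multiplications, hence is itself a left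
multiplication. -/
lemma isDrazinInvertible_leftMul_iff (A : X →L[ℂ] X) :
    IsDrazinInvertible (leftMul A) ↔ IsDrazinInvertible A := by
  constructor
  · rintro ⟨S, m, h₁, h₂, h₃⟩
    have hS : ∀ B : X →L[ℂ] X, S B = S 1 * B := by
      intro B
      have hc : Commute (rightMul B) (leftMul A) :=
        ContinuousLinearMap.ext fun C => mul_assoc A C B
      have := congrArg (fun R : (X →L[ℂ] X) →L[ℂ] (X →L[ℂ] X) => R 1)
        (commute_drazinInverse h₁ h₂ h₃ hc).eq
      have h' : S 1 * B = S (1 * B) := this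
      rw [h', one_mul]
    have e₁ : (leftMul A ^ m) 1 = (leftMul A ^ m) (S (A * 1)) :=
      congrArg (fun R : (X →L[ℂ] X) →L[ℂ] (X →L[ℂ] X) => R 1) h₁
    have e₂ : S (A * S 1) = S 1 :=
      congrArg (fun R : (X →L[ℂ] X) →L[ℂ] (X →L[ℂ] X) => R 1) h₂
    have e₃ : A * S 1 = S (A * 1) :=
      congrArg (fun R : (X →L[ℂ] X) →L[ℂ] (X →L[ℂ] X) => R 1) h₃
    rw [mul_one, hS A] at e₃
    rw [leftMul_pow_apply, leftMul_pow_apply, mul_one, mul_one, hS] at e₁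
    rw [hS] at e₂
    exact ⟨S 1, m, by rw [mul_assoc]; exact e₁, by rw [mul_assoc]; exact e₂, e₃⟩
  · rintro ⟨S, m, h₁, h₂, h₃⟩
    refine ⟨leftMul S, m, ?_, ?_, ?_⟩ <;> refine ContinuousLinearMap.ext fun B => ?_
    · change (leftMul A ^ m) B = (leftMul A ^ m) (S * (A * B))
      rw [leftMul_pow_apply, leftMul_pow_apply, ← mul_assoc, ← mul_assoc, ← h₁]
    · change S * (A * (S * B)) = S * B
      rw [← mul_assoc, ← mul_assoc, h₂]
    · change A * (S * B) = S * (A * B)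
      rw [← mul_assoc, ← mul_assoc, h₃]

/-- The Drazin inverse of `R_A` commutes with all left multiplications, hence is itself a right
multiplication. -/
lemma isDrazinInvertible_rightMul_iff (A : X →L[ℂ] X) :
    IsDrazinInvertible (rightMul A) ↔ IsDrazinInvertible A := by
  constructor
  · rintro ⟨S, m, h₁, h₂, h₃⟩
    have hS : ∀ B : X →L[ℂ] X, S B = B * S 1 := by
      intro B
      have hc : Commute (leftMul B) (rightMul A) :=
        ContinuousLinearMap.ext fun C => (mul_assoc B C A).symm
      have := congrArg (fun R : (X →L[ℂ] X) →L[ℂ] (X →L[ℂ] X) => R 1)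
        (commute_drazinInverse h₁ h₂ h₃ hc).eq
      have h' : B * S 1 = S (B * 1) := this
      rw [h', mul_one]
    have e₁ : (rightMul A ^ m) 1 = (rightMul A ^ m) (S (1 * A)) :=
      congrArg (fun R : (X →L[ℂ] X) →L[ℂ] (X →L[ℂ] X) => R 1) h₁
    have e₂ : S (S 1 * A) = S 1 :=
      congrArg (fun R : (X →L[ℂ] X) →L[ℂ] (X →L[ℂ] X) => R 1) h₂
    have e₃ : S 1 * A = S (1 * A) :=
      congrArg (fun R : (X →L[ℂ] X) →L[ℂ] (X →L[ℂ] X) => R 1) h₃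
    rw [one_mul, hS A] at e₃
    rw [rightMul_pow_apply, rightMul_pow_apply, one_mul, one_mul, hS] at e₁
    rw [hS] at e₂
    have hAS : Commute A (S 1) := e₃.symm
    refine ⟨S 1, m, ?_, e₂, e₃.symm⟩
    rw [mul_assoc, e₃, ((Commute.refl A).pow_left m |>.mul_right (hAS.pow_left m)).eq]
    exact e₁
  · rintro ⟨S, m, h₁, h₂, h₃⟩
    have hAS : Commute A S := h₃
    refine ⟨rightMul S, m, ?_, ?_, ?_⟩ <;> refine ContinuousLinearMap.ext fun B => ?_
    · change (rightMul A ^ m) B = (rightMul A ^ m) (B * A * S)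
      rw [rightMul_pow_apply, rightMul_pow_apply, mul_assoc, mul_assoc, ← mul_assoc A,
        ← ((Commute.refl A).pow_left m |>.mul_right (hAS.pow_left m)).eq, h₃, ← mul_assoc (A ^ m),
        ← h₁]
    · change B * S * A * S = B * S
      rw [mul_assoc, mul_assoc, ← mul_assoc S, h₂]
    · change B * S * A = B * A * S
      rw [mul_assoc, mul_assoc, h₃]

lemma drazinSpectrum_leftMul (A : X →L[ℂ] X) : drazinSpectrum (leftMul A) = drazinSpectrum A := by
  ext z
  rw [drazinSpectrum, drazinSpectrum, Set.mem_ofPred_eq, Set.mem_ofPred_eq, shift_leftMul,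
    isDrazinInvertible_leftMul_iff]

lemma drazinSpectrum_rightMul (A : X →L[ℂ] X) :
    drazinSpectrum (rightMul A) = drazinSpectrum A := by
  ext z
  rw [drazinSpectrum, drazinSpectrum, Set.mem_ofPred_eq, Set.mem_ofPred_eq, shift_rightMul,
    isDrazinInvertible_rightMul_iff]

end Multiplication

/-! ### Eigenvalues near zero -/

section Eigenvalues

variable {E : Type*} [NormedAddCommGroup E] [NormedSpace ℂ E]

/-- If `T` is Drazin invertible with Drazin inverse `S`, then `T x = z x` with `z ≠ 0` gives
`x = z S x`, which is impossible for small `z` unless `x = 0`. -/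
lemma IsDrazinInvertible.eventually_injective_shift {T : E →L[ℂ] E} (h : IsDrazinInvertible T) :
    ∀ᶠ z in nhdsWithin (0 : ℂ) {0}ᶜ, Function.Injective (shift T z) := by
  obtain ⟨S, m, h₁, -, h₃⟩ := h
  have hc : Continuous fun z : ℂ => ‖z • S‖ := by fun_prop
  have ho : ∀ᶠ z in nhds (0 : ℂ), ‖z • S‖ < 1 :=
    (isOpen_Iio.preimage hc).mem_nhds (by simp)
  filter_upwards [ho.filter_mono nhdsWithin_le_nhds, self_mem_nhdsWithin] with z hz hz0
  have hz0' : z ≠ 0 := hz0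
  rw [injective_iff_map_eq_zero]
  intro x hx
  have hTx : T x = z • x := sub_eq_zero.1 hx
  have hpow : ∀ k : ℕ, (T ^ k) x = z ^ k • x := by
    intro k
    induction k with
    | zero => simp
    | succ k ih => rw [pow_succ_apply', ih, map_smul, hTx, smul_smul, pow_succ]
  have hSm : T ^ m = S * T ^ (m + 1) := by
    have hTS : Commute T S := h₃
    rw [pow_succ, ← mul_assoc, ← (hTS.pow_left m).eq, ← h₁]
  have h1 : z ^ m • x = z ^ (m + 1) • S x := by
    rw [← hpow, ← map_smul, ← hpow]
    exact congrArg (fun R : E →L[ℂ] E => R x) hSm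
  have h2 : x = (z • S) x := by
    rw [pow_succ, mul_smul] at h1
    exact smul_right_injective E (pow_ne_zero m hz0') h1
  by_contra hx0
  have h3 : ‖x‖ ≤ ‖z • S‖ * ‖x‖ := by
    conv_lhs => rw [h2]
    exact (z • S).le_opNorm x
  have hpos : 0 < ‖x‖ := norm_pos_iff.2 hx0
  nlinarith

variable [CompleteSpace E]

/-- A surjective operator with a nonzero finite dimensional kernel has every small `z` as an
eigenvalue: if `G` is a right inverse and `T x₀ = 0`, then `(1 - z G)⁻¹ x₀` is an eigenvector. -/
lemma eventually_not_injective_shift_of_surjective {T : E →L[ℂ] E} (hs : Function.Surjective T)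
    (hi : ¬ Function.Injective T) [FiniteDimensional ℂ T.ker] :
    ∀ᶠ z in nhds (0 : ℂ), ¬ Function.Injective (shift T z) := by
  obtain ⟨p, hp⟩ := Submodule.ClosedComplemented.of_finiteDimensional T.ker
  have hk : ∀ v : T.ker, T v = 0 := fun v => v.2
  let e : E ≃L[ℂ] E × T.ker := ContinuousLinearEquiv.ofBijective (T.prod p)
    (LinearMap.ker_eq_bot.2 ((injective_iff_map_eq_zero _).2 fun x hx => by
      have h1 : T x = 0 := congrArg Prod.fst hx
      have h2 : p x = 0 := congrArg Prod.snd hx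
      have h3 : p x = ⟨x, h1⟩ := hp ⟨x, h1⟩
      rw [h2] at h3
      exact (congrArg Subtype.val h3).symm))
    (LinearMap.range_eq_top.2 fun ⟨y, v⟩ => by
      obtain ⟨x, rfl⟩ := hs y
      refine ⟨x - (p x : E) + v, Prod.ext ?_ ?_⟩
      · change T _ = T x
        rw [map_add, map_sub, hk, hk, sub_zero, add_zero]
      · change p _ = v
        rw [map_add, map_sub, hp, hp, sub_self, zero_add])
  let G : E →L[ℂ] E := (e.symm : E × T.ker →L[ℂ] E) ∘L ContinuousLinearMap.inl ℂ E T.ker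
  have hG : ∀ y, T (G y) = y := fun y => congrArg Prod.fst (e.apply_symm_apply (y, 0))
  obtain ⟨x₀, hx₀, hne⟩ : ∃ x₀, T x₀ = 0 ∧ x₀ ≠ 0 := by
    by_contra! h
    exact hi ((injective_iff_map_eq_zero T).2 h)
  have hc : Continuous fun z : ℂ => 1 - z • G := by fun_prop
  have ho : ∀ᶠ z in nhds (0 : ℂ), IsUnit (1 - z • G) :=
    (Units.isOpen.preimage hc).mem_nhds (by simp)
  filter_upwards [ho] with z hz hinj
  obtain ⟨x, hx⟩ := (ContinuousLinearMap.isUnit_iff_bijective.1 hz).2 x₀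
  have hx' : x - z • G x = x₀ := hx
  have hzero : shift T z x = 0 := by
    have h1 := congrArg T hx'
    rwa [map_sub, map_smul, hG, hx₀] at h1
  have hx0 : x = 0 := hinj (hzero.trans (map_zero _).symm)
  apply hne
  rw [← hx', hx0, map_zero, smul_zero, sub_zero]

/-- A Weyl operator is either Drazin invertible or has all small numbers as eigenvalues. The two
cases are told apart by whether the kernel meets the hyperrange `W = ⋂ R(T ^ k)`, which is
mapped onto itself. -/
lemma IsWeyl.isDrazinInvertible_or_eventually_not_injective {T : E →L[ℂ] E} (hT : IsWeyl T) :
    IsDrazinInvertible T ∨ ∀ᶠ z in nhds (0 : ℂ), ¬ Function.Injective (shift T z) := by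
  have hfin : FiniteDimensional ℂ T.ker := hT.1.finite_ker
  let W : Submodule ℂ E := ⨅ k : ℕ, (T ^ k).range
  have hW : ∀ {x}, x ∈ W ↔ ∀ k : ℕ, x ∈ (T ^ k).range := fun {x} => Submodule.mem_iInf _
  have hWcl : IsClosed (W : Set E) := by
    rw [Submodule.coe_iInf]
    exact isClosed_iInter fun k => (hT.pow k).1.isClosed_range
  have : CompleteSpace W := hWcl.completeSpace_coe
  -- The decreasing sequence `N(T) ∩ R(T ^ k)` of finite dimensional spaces stabilizes at some `K`.
  obtain ⟨K, hK⟩ : ∃ K : ℕ, ∀ x ∈ T.ker, x ∈ (T ^ K).range → x ∈ W := by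
    let f : ℕ →o (Submodule ℂ T.ker)ᵒᵈ :=
      { toFun := fun k => OrderDual.toDual ((T ^ k).range.comap T.ker.subtype)
        monotone' := fun m n hmn =>
          OrderDual.toDual_le_toDual.2 (Submodule.comap_mono (range_pow_le_range_pow T hmn)) }
    obtain ⟨K, hK⟩ := monotone_stabilizes_iff_artinian.2
      (inferInstance : IsArtinian ℂ T.ker) f
    refine ⟨K, fun x hx hxK => hW.2 fun k => ?_⟩
    rcases le_total k K with hk | hk
    · exact range_pow_le_range_pow T hk hxK
    · have h1 : (⟨x, hx⟩ : T.ker) ∈ (T ^ K).range.comap T.ker.subtype := hxK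
      have h2 : (T ^ K).range.comap T.ker.subtype = (T ^ k).range.comap T.ker.subtype := hK k hk
      rw [h2] at h1
      exact h1
  have hmaps : Set.MapsTo T W W := fun x hx => hW.2 fun k =>
    mapsTo_range_pow T k (hW.1 hx k)
  by_cases hdis : ∀ x ∈ T.ker, x ∈ W → x = 0
  · left
    -- The kernels stabilize at `K`; as `T ^ K` and `T ^ (K + 1)` have index zero, so do the ranges.
    have hker : (T ^ K).ker = (T ^ (K + 1)).ker := by
      refine le_antisymm (ker_pow_le_ker_pow T (by omega)) fun x hx => ?_
      have hx' : T ((T ^ K) x) = 0 := (pow_succ_apply' T K x).symm.trans hx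
      exact hdis _ hx' (hK _ hx' ⟨x, rfl⟩)
    rw [isDrazinInvertible_iff_exists_stable]
    refine ⟨K, hker, ?_⟩
    obtain ⟨-, hf₁, he₁⟩ := (isWeyl_iff _).1 (hT.pow K)
    obtain ⟨-, hf₂, he₂⟩ := (isWeyl_iff _).1 (hT.pow (K + 1))
    have hle := range_pow_le_range_pow T (Nat.le_succ K)
    let π : (E ⧸ (T ^ (K + 1)).range) →ₗ[ℂ] E ⧸ (T ^ K).range := Submodule.factor hle
    have hπ : Function.Surjective π := Submodule.factor_surjective hle
    have hdim : Module.finrank ℂ (E ⧸ (T ^ (K + 1)).range) =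
        Module.finrank ℂ (E ⧸ (T ^ K).range) := by
      rw [← he₁, ← he₂, hker]
    have hπi : Function.Injective π :=
      (LinearMap.injective_iff_surjective_of_finrank_eq_finrank hdim).2 hπ
    refine le_antisymm (fun x hx => ?_) hle
    rw [← Submodule.Quotient.mk_eq_zero]
    apply hπi
    rw [map_zero]
    exact (Submodule.Quotient.mk_eq_zero _).2 hx
  · right
    push Not at hdis
    obtain ⟨x₀, hx₀, hx₀W, hne⟩ := hdis
    let Q : W →L[ℂ] W := T.restrict hmaps
    have hQs : Function.Surjective Q := by
      rintro ⟨w, hw⟩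
      -- Any preimage of `w` in `R(T ^ K)` lies in `W`.
      have hpre : ∀ k : ℕ, ∃ x ∈ (T ^ k).range, T x = w := by
        intro k
        obtain ⟨y, hy⟩ := hW.1 hw (k + 1)
        exact ⟨(T ^ k) y, ⟨y, rfl⟩, (pow_succ_apply' T k y).symm.trans hy⟩
      obtain ⟨x, hxK, hx⟩ := hpre K
      refine ⟨⟨x, hW.2 fun k => ?_⟩, Subtype.ext hx⟩
      rcases le_total k K with hk | hk
      · exact range_pow_le_range_pow T hk hxK
      · obtain ⟨y, hyk, hy⟩ := hpre k
        have hd : x - y ∈ W := by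
          refine hK _ ?_ ((T ^ K).range.sub_mem hxK (range_pow_le_range_pow T hk hyk))
          change T (x - y) = 0
          rw [map_sub, hx, hy, sub_self]
        have := (T ^ k).range.add_mem (hW.1 hd k) hyk
        rwa [sub_add_cancel] at this
    have hQi : ¬ Function.Injective Q := fun hinj => hne <| by
      have h0 : (⟨x₀, hx₀W⟩ : W) = 0 := hinj (Subtype.ext (by
        rw [map_zero]
        exact hx₀))
      exact congrArg Subtype.val h0
    have : FiniteDimensional ℂ Q.ker := by
      let j : Q.ker →ₗ[ℂ] T.ker :=
        { toFun := fun x => ⟨x.1.1, congrArg Subtype.val x.2⟩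
          map_add' := fun _ _ => rfl
          map_smul' := fun _ _ => rfl }
      refine FiniteDimensional.of_injective j fun x y hxy => ?_
      exact Subtype.ext (Subtype.ext (congrArg (fun v : T.ker => (v : E)) hxy))
    filter_upwards [eventually_not_injective_shift_of_surjective hQs hQi] with z hz hinj
    exact hz fun x y hxy => Subtype.ext (hinj (congrArg (fun v : W => (v : E)) hxy))

end Eigenvalues

/-! ### The generalized Browder's theorem -/

section GeneralizedBrowder

variable {E : Type*} [NormedAddCommGroup E] [NormedSpace ℂ E]

lemma restrictRangePow_pow_apply (T : E →L[ℂ] E) (n k : ℕ) (x : (T ^ n).range) :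
    (((restrictRangePow T n ^ k) x : (T ^ n).range) : E) = (T ^ k) x := by
  induction k generalizing x with
  | zero => rfl
  | succ k ih => rw [pow_succ_apply, pow_succ_apply, ih, restrictRangePow_apply]

lemma isDrazinInvertible_of_restrictRangePow [CompleteSpace E] {T : E →L[ℂ] E} {n : ℕ}
    (h : IsDrazinInvertible (restrictRangePow T n)) : IsDrazinInvertible T := by
  obtain ⟨p, hk, hr⟩ := h.exists_stable
  have hcoe : ∀ (k : ℕ) (x : E),
      (((restrictRangePow T n ^ k) ⟨(T ^ n) x, x, rfl⟩ : (T ^ n).range) : E) = (T ^ (k + n)) x :=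
    fun k x => (restrictRangePow_pow_apply T n k _).trans (pow_add_apply T k n x).symm
  rw [isDrazinInvertible_iff_exists_stable]
  refine ⟨p + n, le_antisymm (ker_pow_le_ker_pow T (by omega)) fun x hx => ?_,
    le_antisymm ?_ (range_pow_le_range_pow T (by omega))⟩
  · have hx' : (T ^ (p + 1 + n)) x = 0 := by
      rw [show p + 1 + n = p + n + 1 by omega]
      exact hx
    have h1 : (⟨(T ^ n) x, x, rfl⟩ : (T ^ n).range) ∈ (restrictRangePow T n ^ p).ker := by
      rw [hk]
      exact Subtype.ext ((hcoe (p + 1) x).trans hx')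
    exact (hcoe p x).symm.trans (congrArg Subtype.val h1)
  · rintro _ ⟨x, rfl⟩
    have h1 : (restrictRangePow T n ^ p) ⟨(T ^ n) x, x, rfl⟩ ∈
        (restrictRangePow T n ^ (p + 1)).range := hr ▸ ⟨_, rfl⟩
    obtain ⟨⟨_, y, rfl⟩, hy⟩ := h1
    refine ⟨y, ?_⟩
    change (T ^ (p + n + 1)) y = (T ^ (p + n)) x
    rw [show p + n + 1 = p + 1 + n by omega, ← hcoe p x, ← hcoe (p + 1) y]
    exact congrArg Subtype.val hy

lemma mapsTo_shift_range_pow (T : E →L[ℂ] E) (n : ℕ) (z : ℂ) :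
    Set.MapsTo (shift T z) ((T ^ n).range : Set E) ((T ^ n).range : Set E) := fun _ hx =>
  (T ^ n).range.sub_mem (mapsTo_range_pow T n hx) ((T ^ n).range.smul_mem z hx)

/-- For `z ≠ 0` the polynomials `X ^ n` and `X - z` are coprime, so `T - z` acts bijectively on the
quotient by `R(T ^ n)`, and being Weyl may be tested on `R(T ^ n)`. -/
lemma isWeyl_shift_restrictRangePow_iff [CompleteSpace E] {T : E →L[ℂ] E} {n : ℕ}
    (hcl : IsClosed ((T ^ n).range : Set E)) {z : ℂ} (hz : z ≠ 0) :
    IsWeyl (shift (restrictRangePow T n) z) ↔ IsWeyl (shift T z) := by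
  have hcomm : Commute T (z • (1 : E →L[ℂ] E)) := (Commute.one_right T).smul_right z
  obtain ⟨q, hqT, hq₁, hq₂⟩ : ∃ q : E →L[ℂ] E, Commute q (T ^ n) ∧
      q * shift T z = T ^ n - z ^ n • (1 : E →L[ℂ] E) ∧ shift T z * q = T ^ n - z ^ n • (1 : E →L[ℂ] E) := by
    refine ⟨∑ i ∈ Finset.range n, T ^ i * (z • (1 : E →L[ℂ] E)) ^ (n - 1 - i), ?_, ?_, ?_⟩
    · exact Commute.sum_left _ _ _ fun i _ => ((Commute.refl T).pow_pow i n).mul_left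
        (hcomm.symm.pow_pow (n - 1 - i) n)
    · rw [shift, hcomm.geom_sum₂_mul, smul_pow, one_pow]
    · rw [shift, hcomm.mul_geom_sum₂, smul_pow, one_pow]
  have hqm : ∀ x ∈ (T ^ n).range, q x ∈ (T ^ n).range := by
    rintro _ ⟨x, rfl⟩
    exact ⟨q x, (congrArg (fun R : E →L[ℂ] E => R x) hqT.eq).symm⟩
  have hzn : z ^ n ≠ 0 := pow_ne_zero n hz
  refine isWeyl_restrict_iff hcl (mapsTo_shift_range_pow T n z) ?_ ?_
  · intro x hx
    have h1 : q (shift T z x) = (T ^ n) x - z ^ n • x :=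
      congrArg (fun R : E →L[ℂ] E => R x) hq₁
    have h2 : z ^ n • x = (T ^ n) x - q (shift T z x) := by rw [h1]; abel
    rw [← (T ^ n).range.smul_mem_iff hzn, h2]
    exact (T ^ n).range.sub_mem ⟨x, rfl⟩ (hqm _ hx)
  · intro y
    have h1 : shift T z (q y) = (T ^ n) y - z ^ n • y :=
      congrArg (fun R : E →L[ℂ] E => R y) hq₂
    refine ⟨-((z ^ n)⁻¹ • q y), ?_⟩
    rw [map_neg, map_smul, h1, smul_sub, inv_smul_smul₀ hzn]
    have : y - -((z ^ n)⁻¹ • (T ^ n) y - y) = (z ^ n)⁻¹ • (T ^ n) y := by abel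
    rw [this]
    exact (T ^ n).range.smul_mem _ ⟨y, rfl⟩

/-- A B-Weyl operator that is not Drazin invertible has all small numbers as eigenvalues, while
all its small nonzero shifts are Weyl. -/
lemma IsBWeyl.isDrazinInvertible_or [CompleteSpace E] {T : E →L[ℂ] E} (hT : IsBWeyl T) :
    IsDrazinInvertible T ∨
      ((∀ᶠ z in nhds (0 : ℂ), ¬ Function.Injective (shift T z)) ∧
        ∀ᶠ z in nhdsWithin (0 : ℂ) {0}ᶜ, IsWeyl (shift T z)) := by
  obtain ⟨n, hcl, hw⟩ := hT
  have : CompleteSpace (T ^ n).range := hcl.completeSpace_coe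
  have hw' : IsWeyl (restrictRangePow T n) := hw
  rcases hw'.isDrazinInvertible_or_eventually_not_injective with hd | hne
  · exact Or.inl (isDrazinInvertible_of_restrictRangePow hd)
  · refine Or.inr ⟨?_, ?_⟩
    · filter_upwards [hne] with z hz hinj
      exact hz fun x y hxy =>
        Subtype.ext (hinj (congrArg (fun v : (T ^ n).range => (v : E)) hxy))
    · filter_upwards [hw'.eventually_shift.filter_mono nhdsWithin_le_nhds, self_mem_nhdsWithin]
        with z hz hz0
      exact (isWeyl_shift_restrictRangePow_iff hcl hz0).1 hz

/-- Browder's theorem and its generalized version are equivalent. If `T - z` were B-Weyl but not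
Drazin invertible, the points near `z` would be eigenvalues, and Browder's theorem would
make some of them Drazin points, around which there are no other eigenvalues. -/
lemma browdersTheorem_iff_bWeylSpectrum_eq [CompleteSpace E] (T : E →L[ℂ] E) :
    BrowdersTheorem T ↔ bWeylSpectrum T = drazinSpectrum T := by
  rw [browdersTheorem_iff, bWeylSpectrum_eq_drazinSpectrum_iff]
  refine ⟨fun h z hz => ?_, fun h z hz => h z hz.isBWeyl⟩
  rcases hz.isDrazinInvertible_or with hd | ⟨hne, hw⟩
  · exact hd
  exfalso
  obtain ⟨w, hww, hwne⟩ :=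
    (hw.and (hne.eventually_nhds.filter_mono nhdsWithin_le_nhds)).exists
  rw [shift_shift] at hww
  have hd := (h _ hww).eventually_injective_shift
  have ht : Filter.Tendsto (fun u : ℂ => w + u) (nhdsWithin 0 {0}ᶜ) (nhds w) := by
    have : Filter.Tendsto (fun u : ℂ => w + u) (nhds 0) (nhds (w + 0)) :=
      (continuous_const.add continuous_id).tendsto 0
    rw [add_zero] at this
    exact this.mono_left nhdsWithin_le_nhds
  obtain ⟨u, hu, hu'⟩ := (hd.and (ht.eventually hwne)).exists
  rw [shift_shift] at hu hu'
  rw [← add_assoc] at hu'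
  exact hu' hu

end GeneralizedBrowder

end BrowderWeyl

open BrowderWeyl in
theorem theorem3p2 {X : Type*} [NormedAddCommGroup X] [NormedSpace ℂ X] [CompleteSpace X]
    (hX : ¬ FiniteDimensional ℂ X) (A : X →L[ℂ] X) :
    -- Browder's theorem holds for the multiplication operators
    (BrowdersTheorem (leftMul A) ∧ BrowdersTheorem (rightMul A)) ∧
    -- the spectra of left multiplication
    (bWeylSpectrum A ⊆ bWeylSpectrum (leftMul A) ∧
      bWeylSpectrum (leftMul A) = drazinSpectrum (leftMul A) ∧
      drazinSpectrum (leftMul A) = drazinSpectrum A) ∧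
    -- the spectra of right multiplication
    (bWeylSpectrum A ⊆ bWeylSpectrum (rightMul A) ∧
      bWeylSpectrum (rightMul A) = drazinSpectrum (rightMul A) ∧
      drazinSpectrum (rightMul A) = drazinSpectrum A) ∧
    -- the characterizations of Browder's theorem for the operator itself
    (BrowdersTheorem A ↔ bWeylSpectrum (leftMul A) = bWeylSpectrum A) ∧
    (BrowdersTheorem A ↔ bWeylSpectrum (rightMul A) = bWeylSpectrum A) := by
  have hL : ∀ z, HasLargeKernels (shift (leftMul A) z) := fun z => by
    rw [shift_leftMul]
    exact hasLargeKernels_leftMul hX _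
  have hR : ∀ z, HasLargeKernels (shift (rightMul A) z) := fun z => by
    rw [shift_rightMul]
    exact hasLargeKernels_rightMul hX _
  have hL' : bWeylSpectrum (leftMul A) = drazinSpectrum (leftMul A) :=
    (bWeylSpectrum_eq_drazinSpectrum_iff _).2 fun z => (hL z).isDrazinInvertible
  have hR' : bWeylSpectrum (rightMul A) = drazinSpectrum (rightMul A) :=
    (bWeylSpectrum_eq_drazinSpectrum_iff _).2 fun z => (hR z).isDrazinInvertible
  have hsub := bWeylSpectrum_subset_drazinSpectrum A
  refine ⟨⟨browdersTheorem_of_hasLargeKernels hL, browdersTheorem_of_hasLargeKernels hR⟩,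
    ⟨?_, hL', drazinSpectrum_leftMul A⟩, ⟨?_, hR', drazinSpectrum_rightMul A⟩, ?_, ?_⟩
  · rwa [hL', drazinSpectrum_leftMul]
  · rwa [hR', drazinSpectrum_rightMul]
  · rw [hL', drazinSpectrum_leftMul, browdersTheorem_iff_bWeylSpectrum_eq, eq_comm]
  · rw [hR', drazinSpectrum_rightMul, browdersTheorem_iff_bWeylSpectrum_eq, eq_comm]
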